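/- Let $n\ge 2$ and $p\ge 1$ be integers. Write $M_k=M_k(\mathbb C)$, let $E_{ij}$ be the matrix units of $M_n$ and let $J_n\subset M_n$ be the space of diagonal matrices of trace $0$. The quotient operator system $M_n/J_n$, with quotient map $q$, has order unit $\dot 1=q(1)$, and $x\in M_k(M_n/J_n)=(M_n/J_n)\otimes M_k$ is positive if and only if $x=[q(H_{ab})]$ for a selfadjoint $H=[H_{ab}]\in M_k(M_n)$ such that for every $\varepsilon>0$ there is a selfadjoint $K_\varepsilon\in M_k(J_n)$ with $\varepsilon 1+H+K_\varepsilon\ge 0$ in $M_k(M_n)$. Put $e_{ij}=q(E_{ij})$. Let $C^*(F_{n-1})$ be the full group C*-algebra of the free group on $n-1$ generators, let $w_2,\dots,w_n$ be its canonical unitary generators, and let $w_1=1$. A ucp map is a unital completely positive linear map. For matrices $A_{11}\in M_p$ and $A_{ij}\in M_p$ ($1\le i,j\le n$, $i\ne j$) the following nine statements are equivalent: 1. $\dot 1\otimes A_{11}+\sum_{i\neq j}e_{ij}\otimes A_{ij}$ is positive in $(M_n/J_n)\otimes M_p$; 2. $1_r\otimes A_{11}+\sum_{i\ne j}\dot\psi(e_{ij})\otimes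 A_{ij}$ is positive in $M_r\otimes M_p$ for every $r\in\mathbb N$ and every ucp map $\dot\psi:M_n/J_n\to M_r$; 3. $1_r\otimes A_{11}+\sum_{i\ne j}\psi(E_{ij})\otimes A_{ij}$ is positive in $M_r\otimes M_p$ for every $r\in\mathbb N$ and every ucp map $\psi:M_n\to M_r$ with $\psi(J_n)=\{0\}$; 4. $1_r\otimes A_{11}+\sum_{i\ne j}\psi(E_{ij})\otimes A_{ij}$ is positive in $M_r\otimes M_p$ for every $r\in\mathbb N$ and every ucp map $\psi:M_n\to M_r$ with $\psi(E_{ii})=\frac1n 1_r$ for all $1\le i\le n$; 5. $1_r\otimes A_{11}+\sum_{i\ne j}B_{ij}\otimes A_{ij}$ is positive in $M_r\otimes M_p$ for every $r\in\mathbb N$ and all $B_{ij}\in M_r$ ($i\neq j$) such that the $n\times n$ block matrix with diagonal blocks $\frac1n 1_r$ and off-diagonal blocks $B_{ij}$ is positive; 6. $1_r\otimes A_{11}+\sum_{i\ne j}\frac1n C_{ij}\otimes A_{ij}$ is positive in $M_r\otimes M_p$ for every $r\in\mathbb N$ and all $C_{ij}\in M_r$ ($i\neq j$) such that the $n\times n$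 block matrix with diagonal blocks $1_r$ and off-diagonal blocks $C_{ij}$ is positive; 7. $1\otimes A_{11}+\sum_{i\ne j}\frac1n w_iw_j^*\otimes A_{ij}$ is positive in $C^*(F_{n-1})\otimes M_p$; 8. there are $B_1,\dots,B_n\in M_p$ with $\sum_{i=1}^n B_i=(n-n^2)A_{11}$ such that $1\otimes nA_{11}+\sum_{i=1}^n E_{ii}\otimes B_i+\sum_{i\ne j}E_{ij}\otimes A_{ij}$ is positive in $M_n\otimes M_p$; 9. there are $R_{ij}\in M_p$ ($1\le i,j\le n$) with $R_{ij}=A_{ij}$ for $i\ne j$ and $R_{11}+\dots+R_{nn}=nA_{11}$ such that $\sum_{i,j=1}^n E_{ij}\otimes R_{ij}$ is positive in $M_n\otimes M_p$. -/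

import Mathlib

open scoped ComplexOrder ENNReal Matrix

noncomputable section

/-! ### Matrix cones, completely positive maps -/

/-- A family of subsets (the positive cones) of the matrix spaces `M_k(V)`, `k ∈ ℕ`. -/
abbrev MatrixCones (V : Type*) := ∀ k : ℕ, Set (Matrix (Fin k) (Fin k) V)

/-- The elementary tensor `v ⊗ A ∈ V ⊗ M_k(ℂ)`, under the identification `V ⊗ M_k(ℂ) = M_k(V)`:
the matrix whose `(a, b)` entry is `A a b • v`. -/
def tensorMat {V : Type*} [SMul ℂ V] {k : ℕ} (v : V) (A : Matrix (Fin k) (Fin k) ℂ) :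
    Matrix (Fin k) (Fin k) V :=
  A.map fun a => a • v

/-- `φ` is completely positive: every amplification `φ^(k) = [φ(x_ab)]` maps the `k`-th cone
into the `k`-th cone. -/
def IsCompletelyPositive {V W : Type*} [AddCommGroup V] [Module ℂ V] [AddCommGroup W] [Module ℂ W]
    (P : MatrixCones V) (Q : MatrixCones W) (φ : V →ₗ[ℂ] W) : Prop :=
  ∀ (k : ℕ) (X : Matrix (Fin k) (Fin k) V), X ∈ P k → X.map φ ∈ Q k

/-- `φ` is a ucp map, for the order units `e` and `f`. -/
def IsUCP {V W : Type*} [AddCommGroup V] [Module ℂ V] [AddCommGroup W] [Module ℂ W]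
    (P : MatrixCones V) (e : V) (Q : MatrixCones W) (f : W) (φ : V →ₗ[ℂ] W) : Prop :=
  IsCompletelyPositive P Q φ ∧ φ e = f

/-- The cones of the operator system `M_n(ℂ)`: a `k × k` matrix over `M_n(ℂ)` is positive when it
is positive semidefinite as a `kn × kn` complex matrix. -/
def matCones (n : ℕ) : MatrixCones (Matrix (Fin n) (Fin n) ℂ) := fun k =>
  {X | (Matrix.comp (Fin k) (Fin k) (Fin n) (Fin n) ℂ X).PosSemidef}

/-- The cones of a unital C*-algebra `𝒜`: the positive elements `Y* Y` of the
C*-algebras `M_k(𝒜)`. -/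
def cstarCones (𝒜 : Type*) [Ring 𝒜] [StarRing 𝒜] : MatrixCones 𝒜 := fun k =>
  {X | ∃ Y : Matrix (Fin k) (Fin k) 𝒜, X = Yᴴ * Y}

/-- The cones `C_k(S/J)` of the quotient operator system `S/J`: those classes of selfadjoint
`H ∈ M_k(S)` such that for every `ε > 0` there is a selfadjoint `K ∈ M_k(J)` with
`ε 1 + H + K` positive in `M_k(S)`. -/
def quotientCones {S : Type*} [AddCommGroup S] [Module ℂ S] [Star S]
    (P : MatrixCones S) (e : S) (J : Submodule ℂ S) : MatrixCones (S ⧸ J) := fun k =>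
  {x | ∃ H : Matrix (Fin k) (Fin k) S, H.IsHermitian ∧ H.map J.mkQ = x ∧
    ∀ ε : ℝ, 0 < ε → ∃ K : Matrix (Fin k) (Fin k) S, K.IsHermitian ∧ (∀ a b, K a b ∈ J) ∧
      tensorMat e ((ε : ℂ) • (1 : Matrix (Fin k) (Fin k) ℂ)) + H + K ∈ P k}

/-! ### The operator system `M_n / J_n` -/

/-- `J_n`: the diagonal matrices of trace zero. -/
def traceZeroDiag (n : ℕ) : Submodule ℂ (Matrix (Fin n) (Fin n) ℂ) where
  carrier := {D | D.IsDiag ∧ D.trace = 0}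
  add_mem' := fun ha hb => ⟨ha.1.add hb.1, by rw [Matrix.trace_add, ha.2, hb.2, add_zero]⟩
  zero_mem' := ⟨Matrix.isDiag_zero, Matrix.trace_zero _ _⟩
  smul_mem' := fun c _ h => ⟨h.1.smul c, by rw [Matrix.trace_smul, h.2, smul_zero]⟩

/-- The vector space `M_n / J_n`. -/
abbrev MatQuot (n : ℕ) := Matrix (Fin n) (Fin n) ℂ ⧸ traceZeroDiag n

/-- The quotient operator system structure of `M_n / J_n`. -/
def matQuotCones (n : ℕ) : MatrixCones (MatQuot n) :=
  quotientCones (matCones n) 1 (traceZeroDiag n)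

/-- The order unit of `M_n / J_n`, the class of the identity matrix. -/
def matQuotOne (n : ℕ) : MatQuot n := (traceZeroDiag n).mkQ 1

/-- `e_ij ∈ M_n / J_n`, the class of the matrix unit `E_ij`. -/
def matQuotUnit (n : ℕ) (i j : Fin n) : MatQuot n :=
  (traceZeroDiag n).mkQ (Matrix.single i j 1)

/-! ### The full group C*-algebra -/

/-- A unitary representation of the group `G` on a nonzero complex Hilbert space. -/
structure UnitaryRep (G : Type) [Group G] : Type 1 where
  H : Type
  [normed : NormedAddCommGroup H]
  [inner : InnerProductSpace ℂ H]
  [complete : CompleteSpace H]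
  [nontrivial : Nontrivial H]
  π : G →* unitary (H →L[ℂ] H)

attribute [instance] UnitaryRep.normed UnitaryRep.inner UnitaryRep.complete UnitaryRep.nontrivial

/-- The C*-algebra of bounded families of operators, indexed by the unitary representations
of `G`, with the supremum norm. -/
abbrev RepProduct (G : Type) [Group G] :=
  lp (fun ρ : UnitaryRep G => ρ.H →L[ℂ] ρ.H) ∞

/-- The universal representation: `g ↦ (ρ(g))_ρ`. -/
def universalRep (G : Type) [Group G] (g : G) : RepProduct G :=
  ⟨fun ρ => (ρ.π g : ρ.H →L[ℂ] ρ.H), memℓp_infty ⟨1, by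
    rintro _ ⟨ρ, rfl⟩
    exact (CStarRing.norm_coe_unitary (ρ.π g)).le⟩⟩

/-- The full group C*-algebra `C*(G)`: the C*-algebra generated by the universal
representation of `G`, that is, the closed unital *-subalgebra generated by its range. Its norm on
the group algebra is the supremum of the norms in all unitary representations. -/
def FullGroupCStar (G : Type) [Group G] : StarSubalgebra ℂ (RepProduct G) :=
  (StarAlgebra.adjoin ℂ (Set.range (universalRep G))).topologicalClosure

/-- The canonical unitary of `C*(G)` that belongs to `g ∈ G`. -/
def groupUnitary (G : Type) [Group G] (g : G) : FullGroupCStar G :=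
  ⟨universalRep G g, StarSubalgebra.le_topologicalClosure _
    (StarAlgebra.subset_adjoin ℂ _ ⟨g, rfl⟩)⟩

/-- The C*-algebra `C*(F_{n-1})` of the free group on `n - 1` generators. -/
abbrev FreeCStar (n : ℕ) := FullGroupCStar (FreeGroup (Fin (n - 1)))

/-- `w_1 = 1`, and `w_2, …, w_n` are the universal unitaries, the generators of `C*(F_{n-1})`
(the indices start at `0` here). -/
def freeUnitary (n : ℕ) (i : Fin n) : FreeCStar n :=
  if h : (i : ℕ) = 0 then 1
  else groupUnitary _ (FreeGroup.of ⟨(i : ℕ) - 1, by omega⟩)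

/-! ### Block matrices -/

/-- The block matrix with all diagonal blocks equal to `D` and off-diagonal blocks `B i j`,
`i ≠ j`, as an element of `M_n(M_r) = M_r ⊗ M_n`. -/
def blockWithDiag {n r : ℕ} (D : Matrix (Fin r) (Fin r) ℂ)
    (B : Fin n → Fin n → Matrix (Fin r) (Fin r) ℂ) :
    Matrix (Fin n) (Fin n) (Matrix (Fin r) (Fin r) ℂ) :=
  Matrix.of fun i j => if i = j then D else B i j

end

noncomputable section

/-! In the quotient all `e_ii` coincide, so each equals `1/n` times the unit. An element of `M_n/J_n
⊗ M_p` therefore remembers only the off-diagonal blocks and the sum of the diagonal blocks of a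
lift. Condition 9, the existence of a positive lift with these data, is the hub of the equivalence.

The chain 1 → 6 is formal. Ucp maps on the quotient are ucp maps killing `J_n`, these include the
maps sending each `E_ii` to `1/n`, and positive Choi matrices with diagonal blocks `1/n` supply such
maps.

The main step is 6 → 9, by duality. The linear map that forgets all but the off-diagonal blocks and
the diagonal sum sends the positive semidefinite cone to a closed cone
(`isClosed_sumDiagBlocks_image`). If no completion exists, Hahn–Banach separates, and the Hermitian
part of the separating functional is a positive block matrix with constant diagonal blocks
(`exists_posSemidef_sumDiagBlocks_eq`). Normalising such a matrix to identity diagonal blocks turns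
it into an admissible `C`, and evaluating condition 6 at one vector contradicts the separation
(`entrySum_nonneg_of_compress`).

A completion represents the class in the quotient, giving 9 → 1. Factoring it as `S* S` exhibits the
element over `C*(F_{n-1})` as a sum of squares, giving 9 → 7. For 7 → 6, an admissible `C` is
factored through isometries, which extend to unitaries `u_i` with `C_ij` a compression of `u_i* u_j`
(`exists_unitary_dilation`). -/

/-! ### Elementary tensors and off-diagonal sums -/

theorem tensorMat_apply {V : Type*} [SMul ℂ V] {k : ℕ} (v : V) (A : Matrix (Fin k) (Fin k) ℂ)
    (a b : Fin k) : tensorMat v A a b = A a b • v := rfl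

theorem tensorMat_combination_map {V W : Type*} [AddCommGroup V] [Module ℂ V] [AddCommGroup W]
    [Module ℂ W] {k : ℕ} {ι : Type*} (φ : V →ₗ[ℂ] W) (e : V) (A : Matrix (Fin k) (Fin k) ℂ)
    (s : Finset ι) (v : ι → V) (B : ι → Matrix (Fin k) (Fin k) ℂ) :
    (tensorMat e A + ∑ x ∈ s, tensorMat (v x) (B x)).map φ =
      tensorMat (φ e) A + ∑ x ∈ s, tensorMat (φ (v x)) (B x) := by
  ext a b; simp [tensorMat_apply, Matrix.sum_apply]

theorem offDiag_combination_mem_congr {V : Type*} [AddCommGroup V] [Module ℂ V] {n k : ℕ}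
    {Q : Set (Matrix (Fin k) (Fin k) V)} {e : V} {A₁₁ : Matrix (Fin k) (Fin k) ℂ}
    {A : Fin n → Fin n → Matrix (Fin k) (Fin k) ℂ} {v w : Fin n × Fin n → V}
    (h : tensorMat e A₁₁ + ∑ x ∈ (Finset.univ : Finset (Fin n)).offDiag,
      tensorMat (v x) (A x.1 x.2) ∈ Q) (hvw : ∀ x, x.1 ≠ x.2 → v x = w x) :
    tensorMat e A₁₁ + ∑ x ∈ (Finset.univ : Finset (Fin n)).offDiag,
      tensorMat (w x) (A x.1 x.2) ∈ Q := by
  rwa [Finset.sum_congr rfl fun x hx => by rw [hvw x (Finset.mem_offDiag.mp hx).2.2]] at h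

theorem sum_offDiag_add_sum_diag {ι M : Type*} [Fintype ι] [DecidableEq ι] [AddCommMonoid M]
    (f : ι → ι → M) :
    ∑ i, f i i + ∑ x ∈ (Finset.univ : Finset ι).offDiag, f x.1 x.2 = ∑ i, ∑ j, f i j := by
  rw [← Finset.sum_product', ← Finset.diag_union_offDiag,
    Finset.sum_union (Finset.disjoint_diag_offDiag _), Finset.sum_diag]

/-- A double sum `∑ v_ij ⊗ R_ij` only depends on the off-diagonal `R_ij` and on the sum of the
`R_ii`, when the `v_ii` all coincide. -/
theorem sum_tensorMat_eq {V : Type*} [AddCommGroup V] [Module ℂ V] {n p : ℕ} (hn : n ≠ 0)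
    {e : V} {v : Fin n → Fin n → V} (hv : ∀ i, v i i = (1 / (n : ℂ)) • e)
    {A₁₁ : Matrix (Fin p) (Fin p) ℂ} {A R : Fin n → Fin n → Matrix (Fin p) (Fin p) ℂ}
    (hR : ∀ i j, i ≠ j → R i j = A i j) (hsum : ∑ i, R i i = (n : ℂ) • A₁₁) :
    ∑ i, ∑ j, tensorMat (v i j) (R i j) =
      tensorMat e A₁₁ +
        ∑ x ∈ (Finset.univ : Finset (Fin n)).offDiag, tensorMat (v x.1 x.2) (A x.1 x.2) := by
  rw [← sum_offDiag_add_sum_diag]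
  congr 1
  · ext a b
    have h := congr_fun (congr_fun hsum a) b
    simp only [Matrix.sum_apply, Matrix.smul_apply, smul_eq_mul] at h
    have hn' : (n : ℂ) ≠ 0 := Nat.cast_ne_zero.mpr hn
    simp only [Matrix.sum_apply, tensorMat_apply, hv]
    rw [← Finset.sum_smul, h, smul_smul]
    congr 1
    field_simp
  · refine Finset.sum_congr rfl fun x hx => ?_
    rw [hR _ _ (Finset.mem_offDiag.mp hx).2.2]

/-! ### Positive block matrices and Choi matrices -/

/-- Conjugation by the column whose blocks are all the identity adds up the blocks. -/
theorem Matrix.PosSemidef.sum_blocks {ι β : Type*} [Fintype ι] [Fintype β]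
    {P : Matrix (ι × β) (ι × β) ℂ} (hP : P.PosSemidef) :
    (Matrix.of fun x y => ∑ i, ∑ j, P (i, x) (j, y)).PosSemidef := by
  classical
  have h := hP.conjTranspose_mul_mul_same
    (Matrix.of fun (x : ι × β) (y : β) => if x.2 = y then (1 : ℂ) else 0)
  convert h using 1
  ext x y
  simp only [Matrix.of_apply, Matrix.mul_apply, Matrix.conjTranspose_apply, Fintype.sum_prod_type,
    apply_ite star, star_one, star_zero, ite_mul, one_mul, zero_mul, mul_ite, mul_one, mul_zero,
    Finset.sum_ite_eq', Finset.mem_univ, if_true]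
  rw [Finset.sum_comm]

/-- The contraction over the common index of two positive semidefinite block matrices is positive
semidefinite. -/
theorem Matrix.PosSemidef.contract {α ι σ : Type*} [Fintype α] [Fintype ι] [Fintype σ]
    {R : Matrix (α × ι) (α × ι) ℂ} {B : Matrix (ι × σ) (ι × σ) ℂ}
    (hR : R.PosSemidef) (hB : B.PosSemidef) :
    (Matrix.of fun x y : α × σ =>
      ∑ i, ∑ j, R (x.1, i) (y.1, j) * B (i, x.2) (j, y.2)).PosSemidef := by
  have h := (hR.kronecker hB).submatrix fun z : ι × (α × σ) => ((z.2.1, z.1), (z.1, z.2.2))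
  exact h.sum_blocks

open scoped MatrixOrder in
theorem Matrix.PosSemidef.exists_eq_conjTranspose_mul_self {ι : Type*} [Fintype ι]
    {P : Matrix ι ι ℂ} (hP : P.PosSemidef) : ∃ S : Matrix ι ι ℂ, P = Sᴴ * S := by
  classical
  exact CStarAlgebra.nonneg_iff_eq_star_mul_self.mp hP.nonneg

theorem mem_matCones {r k : ℕ} {X : Matrix (Fin k) (Fin k) (Matrix (Fin r) (Fin r) ℂ)} :
    X ∈ matCones r k ↔ (Matrix.of fun x y : Fin k × Fin r => X x.1 y.1 x.2 y.2).PosSemidef :=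
  Iff.rfl

/-- A positive semidefinite block matrix is the Choi matrix of a completely positive map. -/
theorem isCompletelyPositive_of_choi {n r : ℕ}
    {B : Matrix (Fin n) (Fin n) (Matrix (Fin r) (Fin r) ℂ)} (hB : B ∈ matCones r n)
    {ψ : Matrix (Fin n) (Fin n) ℂ →ₗ[ℂ] Matrix (Fin r) (Fin r) ℂ}
    (hψ : ∀ X, ψ X = ∑ i, ∑ j, X i j • B i j) :
    IsCompletelyPositive (matCones n) (matCones r) ψ := by
  intro k X hX
  rw [mem_matCones] at hX hB ⊢
  convert hX.contract hB using 3
  simp [hψ, Matrix.sum_apply]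

/-- The linear map with prescribed values on the matrix units. -/
def ofChoi {n r : ℕ} (B : Matrix (Fin n) (Fin n) (Matrix (Fin r) (Fin r) ℂ)) :
    Matrix (Fin n) (Fin n) ℂ →ₗ[ℂ] Matrix (Fin r) (Fin r) ℂ where
  toFun X := ∑ i, ∑ j, X i j • B i j
  map_add' X Y := by simp [add_smul, Finset.sum_add_distrib]
  map_smul' c X := by simp [Finset.smul_sum, smul_smul]

theorem ofChoi_apply {n r : ℕ} (B : Matrix (Fin n) (Fin n) (Matrix (Fin r) (Fin r) ℂ))
    (X : Matrix (Fin n) (Fin n) ℂ) : ofChoi B X = ∑ i, ∑ j, X i j • B i j := rfl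

theorem ofChoi_single {n r : ℕ} (B : Matrix (Fin n) (Fin n) (Matrix (Fin r) (Fin r) ℂ))
    (i j : Fin n) :
    ofChoi B (Matrix.single i j 1) = B i j := by
  rw [ofChoi_apply, Finset.sum_eq_single i, Finset.sum_eq_single j]
  · simp
  · intro b _ hb; simp [hb.symm]
  · simp
  · intro b _ hb; simp [hb.symm]
  · simp

/-! ### The quotient by the trace-zero diagonal matrices -/

theorem mem_traceZeroDiag {n : ℕ} {D : Matrix (Fin n) (Fin n) ℂ} :
    D ∈ traceZeroDiag n ↔ D.IsDiag ∧ D.trace = 0 := Iff.rfl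

theorem single_sub_single_mem_traceZeroDiag {n : ℕ} (i j : Fin n) :
    Matrix.single i i (1 : ℂ) - Matrix.single j j 1 ∈ traceZeroDiag n := by
  refine mem_traceZeroDiag.2 ⟨fun a b hab => ?_, ?_⟩
  · simp only [Matrix.sub_apply, Matrix.single_apply]
    grind
  · simp [Matrix.trace_sub, Matrix.trace_single_eq_same]

theorem one_eq_sum_single (n : ℕ) :
    (1 : Matrix (Fin n) (Fin n) ℂ) = ∑ i, Matrix.single i i 1 := by
  rw [Matrix.sum_single_eq_diagonal, ← Matrix.diagonal_one]

theorem matQuotUnit_self {n : ℕ} (hn : n ≠ 0) (i : Fin n) :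
    matQuotUnit n i i = (1 / (n : ℂ)) • matQuotOne n := by
  have h : ∀ j, matQuotUnit n j j = matQuotUnit n i i := fun j =>
    (Submodule.Quotient.eq _).2 (single_sub_single_mem_traceZeroDiag j i)
  have hn' : (n : ℂ) ≠ 0 := Nat.cast_ne_zero.mpr hn
  have h1 : matQuotOne n = (n : ℂ) • matQuotUnit n i i := by
    rw [matQuotOne, one_eq_sum_single, map_sum]
    change ∑ j, matQuotUnit n j j = _
    simp [h, ← Nat.cast_smul_eq_nsmul ℂ]
  rw [h1, smul_smul, one_div, inv_mul_cancel₀ hn', one_smul]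

/-- On a diagonal matrix `ψ D = tr(D) c`. -/
theorem eq_zero_of_mem_traceZeroDiag {n r : ℕ}
    {ψ : Matrix (Fin n) (Fin n) ℂ →ₗ[ℂ] Matrix (Fin r) (Fin r) ℂ}
    {c : Matrix (Fin r) (Fin r) ℂ} (hψ : ∀ i, ψ (Matrix.single i i 1) = c)
    {D : Matrix (Fin n) (Fin n) ℂ} (hD : D ∈ traceZeroDiag n) : ψ D = 0 := by
  obtain ⟨h1, h2⟩ := mem_traceZeroDiag.1 hD
  have h : D = ∑ i, D i i • Matrix.single i i (1 : ℂ) := by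
    conv_lhs => rw [← h1.diagonal_diag]
    rw [← Matrix.sum_single_eq_diagonal]
    simp [Matrix.smul_single]
  rw [h, map_sum]
  simp only [map_smul, hψ]
  rw [← Finset.sum_smul]
  have : ∑ i, D i i = 0 := h2
  rw [this, zero_smul]

/-- A positive semidefinite matrix is a limit of the matrices obtained by adding `ε • 1`. -/
theorem Matrix.PosSemidef.of_forall_add_smul_one {ι : Type*} [Fintype ι] [DecidableEq ι]
    {M : Matrix ι ι ℂ} (hM : M.IsHermitian)
    (h : ∀ ε : ℝ, 0 < ε → ((ε : ℂ) • (1 : Matrix ι ι ℂ) + M).PosSemidef) : M.PosSemidef := by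
  refine .of_dotProduct_mulVec_nonneg hM fun x => ?_
  have key : ∀ ε : ℝ, 0 < ε → 0 ≤ (ε : ℂ) * (star x ⬝ᵥ x) + star x ⬝ᵥ M *ᵥ x := fun ε hε => by
    have := (h ε hε).dotProduct_mulVec_nonneg x
    simpa [Matrix.add_mulVec, Matrix.smul_mulVec, dotProduct_add, dotProduct_smul] using this
  have hlim : Filter.Tendsto (fun ε : ℝ => (ε : ℂ) * (star x ⬝ᵥ x) + star x ⬝ᵥ M *ᵥ x)
      (nhdsWithin 0 (Set.Ioi 0)) (nhds (star x ⬝ᵥ M *ᵥ x)) := by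
    have : Continuous fun ε : ℝ => (ε : ℂ) * (star x ⬝ᵥ x) + star x ⬝ᵥ M *ᵥ x := by fun_prop
    simpa using (this.tendsto 0).mono_left nhdsWithin_le_nhds
  exact ge_of_tendsto hlim (eventually_nhdsWithin_of_forall fun ε hε => key ε hε)

/-- A ucp map into matrices that vanishes on `J` descends to a ucp map on the quotient. -/
theorem IsUCP.liftQ {n r : ℕ} {J : Submodule ℂ (Matrix (Fin n) (Fin n) ℂ)}
    {ψ : Matrix (Fin n) (Fin n) ℂ →ₗ[ℂ] Matrix (Fin r) (Fin r) ℂ}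
    (hψ : IsUCP (matCones n) 1 (matCones r) 1 ψ) (hJ : ∀ D ∈ J, ψ D = 0) :
    IsUCP (quotientCones (matCones n) 1 J) (J.mkQ 1) (matCones r) 1
      (J.liftQ ψ fun D hD => hJ D hD) := by
  refine ⟨?_, hψ.2⟩
  rintro k _ ⟨H, hH, rfl, hε⟩
  have hmap : (H.map J.mkQ).map (J.liftQ ψ fun D hD => hJ D hD) = H.map ψ := rfl
  rw [hmap, mem_matCones]
  -- The correction `K` disappears because `ψ` kills `J`, and unitality turns the `ε` term into `ε`
  -- times the identity.
  have key : ∀ ε : ℝ, 0 < ε → ((ε : ℂ) • (1 : Matrix (Fin k × Fin r) (Fin k × Fin r) ℂ) +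
      Matrix.of fun x y : Fin k × Fin r => (H.map ψ) x.1 y.1 x.2 y.2).PosSemidef := by
    intro ε hpos
    obtain ⟨K, -, hKJ, hK⟩ := hε ε hpos
    have h := mem_matCones.1 (hψ.1 k _ hK)
    convert h using 1
    ext x y
    simp only [Matrix.add_apply, Matrix.smul_apply, Matrix.of_apply, Matrix.map_apply, map_add,
      tensorMat_apply, map_smul, hψ.2, hJ _ (hKJ _ _), Matrix.zero_apply, add_zero,
      smul_eq_mul, Matrix.one_apply, Prod.ext_iff]
    by_cases h1 : x.1 = y.1 <;> by_cases h2 : x.2 = y.2 <;> simp [h1, h2]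
  refine .of_forall_add_smul_one ?_ key
  have h1 := (key 1 one_pos).1.sub
    (Matrix.isHermitian_one (n := Fin k × Fin r) (α := ℂ))
  simpa using h1

/-! ### Positivity over C*-algebras and the full group C*-algebra -/

theorem CStarAlgebra.exists_sum_star_mul_self_eq {𝒜 : Type*} [CStarAlgebra 𝒜] {ι : Type*}
    (s : Finset ι) (y : ι → 𝒜) : ∃ z : 𝒜, ∑ c ∈ s, star (y c) * y c = star z * z := by
  let := CStarAlgebra.spectralOrder 𝒜
  have := CStarAlgebra.spectralOrderedRing 𝒜
  exact CStarAlgebra.nonneg_iff_eq_star_mul_self.mp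
    (Finset.sum_nonneg fun c _ => star_mul_self_nonneg (y c))

/-- Over a C*-algebra, sums of matrices `y* y` with `y` a row are of the form `Y* Y`. -/
theorem sum_star_mul_mem_cstarCones {𝒜 : Type*} [CStarAlgebra 𝒜] {k : ℕ} {ι : Type*}
    (s : Finset ι) (y : ι → Fin k → 𝒜) :
    (Matrix.of fun a b => ∑ c ∈ s, star (y c a) * y c b) ∈ cstarCones 𝒜 k := by
  let := CStarAlgebra.spectralOrder 𝒜
  have := CStarAlgebra.spectralOrderedRing 𝒜
  rcases k with _ | k
  · exact ⟨0, Subsingleton.elim _ _⟩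
  -- Each row is padded by zero rows to a square matrix, so that the sum lives in the C*-algebra of
  -- matrices over `𝒜`. The row with index `0` requires a nonzero size.
  let Y : ι → Matrix (Fin (k + 1)) (Fin (k + 1)) 𝒜 :=
    fun c => Matrix.of fun a b => if a = 0 then y c b else 0
  obtain ⟨Z, hZ⟩ := CStarAlgebra.exists_sum_star_mul_self_eq
    (𝒜 := CStarMatrix (Fin (k + 1)) (Fin (k + 1)) 𝒜) s fun c => CStarMatrix.ofMatrix (Y c)
  refine ⟨CStarMatrix.ofMatrix.symm Z, ?_⟩
  have hS : (Matrix.of fun a b => ∑ c ∈ s, star (y c a) * y c b) = ∑ c ∈ s, (Y c)ᴴ * Y c := by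
    ext a b
    simp only [Matrix.of_apply, Matrix.sum_apply, Matrix.mul_apply, Matrix.conjTranspose_apply]
    refine Finset.sum_congr rfl fun c _ => ?_
    rw [Finset.sum_eq_single 0]
    · simp [Y]
    · intro d _ hd; simp [Y, hd]
    · simp
  rw [hS]
  exact hZ

/-- Evaluation of the universal representation at one representation. -/
def RepProduct.eval {G : Type} [Group G] (ρ : UnitaryRep G) :
    RepProduct G →⋆ₐ[ℂ] (ρ.H →L[ℂ] ρ.H) where
  toFun f := f ρ
  map_one' := rfl
  map_mul' _ _ := rfl
  map_zero' := rfl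
  map_add' _ _ := rfl
  commutes' _ := rfl
  map_star' _ := rfl

/-- The representation of `C*(G)` that extends a unitary representation of `G`. -/
def FullGroupCStar.lift {G : Type} [Group G] (ρ : UnitaryRep G) :
    FullGroupCStar G →⋆ₐ[ℂ] (ρ.H →L[ℂ] ρ.H) :=
  (RepProduct.eval ρ).comp (FullGroupCStar G).subtype

theorem FullGroupCStar.lift_groupUnitary {G : Type} [Group G] (ρ : UnitaryRep G) (g : G) :
    FullGroupCStar.lift ρ (groupUnitary G g) = (ρ.π g : ρ.H →L[ℂ] ρ.H) := rfl

theorem groupUnitary_mul_star (G : Type) [Group G] (g : G) :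
    groupUnitary G g * star (groupUnitary G g) = 1 := by
  apply Subtype.ext
  apply Subtype.ext
  funext ρ
  exact Unitary.mul_star_self_of_mem (ρ.π g).2

theorem groupUnitary_one (G : Type) [Group G] : groupUnitary G 1 = 1 := by
  apply Subtype.ext
  apply Subtype.ext
  funext ρ
  exact congr_arg Subtype.val (map_one ρ.π)

/-- The element of the free group that corresponds to the `i`-th canonical unitary. -/
def freeIndex (n : ℕ) (i : Fin n) : FreeGroup (Fin (n - 1)) :=
  if h : (i : ℕ) = 0 then 1 else FreeGroup.of ⟨(i : ℕ) - 1, by omega⟩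

theorem freeUnitary_eq (n : ℕ) (i : Fin n) :
    freeUnitary n i = groupUnitary _ (freeIndex n i) := by
  unfold freeUnitary freeIndex
  split
  · exact (groupUnitary_one _).symm
  · rfl

theorem freeUnitary_mul_star (n : ℕ) (i : Fin n) :
    freeUnitary n i * star (freeUnitary n i) = 1 := by
  rw [freeUnitary_eq, groupUnitary_mul_star]

noncomputable instance (G : Type) [Group G] : CStarAlgebra (RepProduct G) where

instance (G : Type) [Group G] : IsClosed (FullGroupCStar G : Set (RepProduct G)) :=
  StarSubalgebra.isClosed_topologicalClosure _

theorem sum_sum_single_mem_matCones {n p : ℕ} {R : Fin n → Fin n → Matrix (Fin p) (Fin p) ℂ} :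
    ∑ i, ∑ j, tensorMat (Matrix.single i j (1 : ℂ)) (R i j) ∈ matCones n p ↔
      (Matrix.of fun x y : Fin p × Fin n => R x.2 y.2 x.1 y.1).PosSemidef := by
  rw [mem_matCones]
  have : (Matrix.of fun x y : Fin p × Fin n =>
      (∑ i, ∑ j, tensorMat (Matrix.single i j (1 : ℂ)) (R i j)) x.1 y.1 x.2 y.2) =
      Matrix.of fun x y : Fin p × Fin n => R x.2 y.2 x.1 y.1 := by
    ext x y
    simp [Matrix.sum_apply, tensorMat_apply, Matrix.single_apply, ite_and]
  rw [this]

/-- If `[R_ij]` is positive semidefinite, then `∑ w_i w_j* ⊗ R_ij` is positive. -/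
theorem sum_tensorMat_mul_star_mem_cstarCones {𝒜 : Type*} [CStarAlgebra 𝒜] {n p : ℕ}
    {R : Fin n → Fin n → Matrix (Fin p) (Fin p) ℂ}
    (hR : (Matrix.of fun x y : Fin p × Fin n => R x.2 y.2 x.1 y.1).PosSemidef)
    (w : Fin n → 𝒜) :
    ∑ i, ∑ j, tensorMat ((1 / (n : ℂ)) • (w i * star (w j))) (R i j) ∈ cstarCones 𝒜 p := by
  obtain ⟨S, hS⟩ := hR.exists_eq_conjTranspose_mul_self
  have hS' : ∀ i j a b, R i j a b = ∑ c, star (S c (a, i)) * S c (b, j) := fun i j a b => by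
    have := congr_fun (congr_fun hS (a, i)) (b, j)
    simpa [Matrix.mul_apply] using this
  -- The scalar `1/n` is split evenly between the two factors of `y* y`.
  have hn : (1 / (n : ℂ)) = star ((Real.sqrt (1 / n) : ℝ) : ℂ) * ((Real.sqrt (1 / n) : ℝ) : ℂ) := by
    rw [Complex.star_def, Complex.conj_ofReal, ← Complex.ofReal_mul,
      Real.mul_self_sqrt (by positivity)]
    simp
  convert sum_star_mul_mem_cstarCones Finset.univ
    (fun c a => ((Real.sqrt (1 / n) : ℝ) : ℂ) • ∑ j, S c (a, j) • star (w j)) using 1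
  ext a b
  simp only [Matrix.sum_apply, tensorMat_apply, Matrix.of_apply, star_smul, star_sum, star_star,
    hS', smul_mul_smul_comm, ← hn, Finset.sum_mul_sum, ← Finset.smul_sum]
  simp only [Finset.smul_sum]
  conv_rhs =>
    rw [Finset.sum_comm]
    enter [2, i]
    rw [Finset.sum_comm]
  refine Finset.sum_congr rfl fun i _ => Finset.sum_congr rfl fun j _ => ?_
  rw [Finset.sum_smul]
  refine Finset.sum_congr rfl fun c _ => ?_
  rw [smul_comm]

/-! ### Dilation to unitaries -/

/-- A family of isometries with values in a finite-dimensional space is obtained from one of them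
by composition with unitaries. -/
theorem exists_unitary_comp_isometry {E H : Type*} [NormedAddCommGroup E] [InnerProductSpace ℂ E]
    [NormedAddCommGroup H] [InnerProductSpace ℂ H] [FiniteDimensional ℂ H] [CompleteSpace H]
    (V₀ V : E →ₗᵢ[ℂ] H) : ∃ u : unitary (H →L[ℂ] H), ∀ x, (u : H →L[ℂ] H) (V₀ x) = V x := by
  -- `L` is `V V₀⁻¹` on the range of `V₀`; in finite dimension this partial isometry extends to a
  -- unitary.
  let L := V.comp V₀.equivRange.symm.toLinearIsometry
  refine ⟨Unitary.linearIsometryEquiv.symm (L.extend.toLinearIsometryEquiv rfl), fun x => ?_⟩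
  have h := L.extend_apply (V₀.equivRange x)
  simpa [L] using h

theorem exists_isometry_of_conjTranspose_mul_self_eq_one {ι κ : Type*} [Fintype ι] [Fintype κ]
    [DecidableEq κ] {S : Matrix ι κ ℂ} (hS : Sᴴ * S = 1) :
    ∃ V : EuclideanSpace ℂ κ →ₗᵢ[ℂ] EuclideanSpace ℂ ι,
      ∀ x, V x = WithLp.toLp 2 (S *ᵥ x.ofLp) := by
  let f : EuclideanSpace ℂ κ →ₗ[ℂ] EuclideanSpace ℂ ι :=
    { toFun := fun x => WithLp.toLp 2 (S *ᵥ x.ofLp)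
      map_add' := fun x y => by simp [Matrix.mulVec_add]
      map_smul' := fun c x => by simp [Matrix.mulVec_smul] }
  refine ⟨f.isometryOfInner fun x y => ?_, fun x => rfl⟩
  simp only [f, LinearMap.coe_mk, AddHom.coe_mk, EuclideanSpace.inner_eq_star_dotProduct]
  rw [Matrix.star_mulVec, dotProduct_comm, ← Matrix.dotProduct_mulVec, Matrix.mulVec_mulVec, hS,
    Matrix.one_mulVec, dotProduct_comm]

/-- A positive semidefinite block matrix with identity diagonal blocks dilates to a family of
unitaries on a finite-dimensional Hilbert space, the first of which is `1`. -/
theorem exists_unitary_dilation {n r : ℕ} (i₀ : Fin n)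
    {C : Fin n → Fin n → Matrix (Fin r) (Fin r) ℂ} (hC : blockWithDiag 1 C ∈ matCones r n) :
    ∃ (u : Fin n → unitary (EuclideanSpace ℂ (Fin n × Fin r) →L[ℂ]
        EuclideanSpace ℂ (Fin n × Fin r)))
      (v : Fin r → EuclideanSpace ℂ (Fin n × Fin r)), u i₀ = 1 ∧
      ∀ i j s t, inner ℂ ((u i).val (v s)) ((u j).val (v t)) =
        blockWithDiag 1 C i j s t := by
  obtain ⟨S, hS⟩ := (mem_matCones.1 hC).exists_eq_conjTranspose_mul_self
  -- The block columns `S_i` of `S` satisfy `S_i* S_j = C_ij` off the diagonal and `S_i* S_i = 1`,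
  -- so they are isometries.
  have hS' : ∀ i j, (S.submatrix id (Prod.mk i))ᴴ * S.submatrix id (Prod.mk j) =
      blockWithDiag 1 C i j := fun i j => by
    ext s t
    exact (congr_fun (congr_fun hS (i, s)) (j, t)).symm
  have hV := fun i => exists_isometry_of_conjTranspose_mul_self_eq_one
    ((hS' i i).trans (by simp [blockWithDiag]))
  choose V hV using hV
  choose u hu using fun i => exists_unitary_comp_isometry (V i₀) (V i)
  -- The unitary found for `i₀` is only known to be the identity on the range of `V i₀`; replacing
  -- it by `1` is harmless, since only that range is used.
  refine ⟨fun i => if i = i₀ then 1 else u i, fun s => V i₀ (EuclideanSpace.single s 1),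
    if_pos rfl, fun i j s t => ?_⟩
  have hu' : ∀ i x, (if i = i₀ then 1 else u i).val (V i₀ x) = V i x := by
    intro i x
    split
    · subst i; rfl
    · exact hu i x
  rw [hu', hu', hV, hV, EuclideanSpace.inner_eq_star_dotProduct, ← hS' i j]
  simp [Matrix.mul_apply, dotProduct, mul_comm]

/-- Positive matrices over `B(H)` compress to positive semidefinite matrices. -/
theorem posSemidef_inner_of_eq_conjTranspose_mul_self {H : Type*} [NormedAddCommGroup H]
    [InnerProductSpace ℂ H] [CompleteSpace H] {p r : ℕ}
    {Z Y : Matrix (Fin p) (Fin p) (H →L[ℂ] H)} (hZ : Z = Yᴴ * Y) (v : Fin r → H) :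
    (Matrix.of fun x y : Fin p × Fin r => inner ℂ (v x.2) (Z x.1 y.1 (v y.2))).PosSemidef := by
  have h : (Matrix.of fun x y : Fin p × Fin r => inner ℂ (v x.2) (Z x.1 y.1 (v y.2))) =
      ∑ c, Matrix.gram ℂ fun x : Fin p × Fin r => Y c x.1 (v x.2) := by
    ext x y
    simp [hZ, Matrix.mul_apply, Matrix.sum_apply, Matrix.gram_apply,
      ContinuousLinearMap.star_eq_adjoint, ContinuousLinearMap.adjoint_inner_right]
  rw [h]
  exact Matrix.posSemidef_sum _ fun c _ => Matrix.posSemidef_gram _ _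

theorem map_mem_cstarCones {𝒜 ℬ : Type*} [Ring 𝒜] [StarRing 𝒜] [Algebra ℂ 𝒜]
    [Ring ℬ] [StarRing ℬ] [Algebra ℂ ℬ] (φ : 𝒜 →⋆ₐ[ℂ] ℬ) {k : ℕ}
    {X : Matrix (Fin k) (Fin k) 𝒜} (hX : X ∈ cstarCones 𝒜 k) : X.map φ ∈ cstarCones ℬ k := by
  obtain ⟨Y, rfl⟩ := hX
  refine ⟨Y.map φ, ?_⟩
  ext a b
  simp [Matrix.mul_apply, map_star]

theorem combination_mul_star_mem_cstarCones {𝒜 ℬ : Type*} [Ring 𝒜] [StarRing 𝒜] [Algebra ℂ 𝒜]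
    [Ring ℬ] [StarRing ℬ] [Algebra ℂ ℬ] (φ : 𝒜 →⋆ₐ[ℂ] ℬ) {n p : ℕ} (c : ℂ)
    {A₁₁ : Matrix (Fin p) (Fin p) ℂ} {A : Fin n → Fin n → Matrix (Fin p) (Fin p) ℂ}
    {s : Finset (Fin n × Fin n)} {w : Fin n → 𝒜}
    (h : tensorMat (1 : 𝒜) A₁₁ + ∑ x ∈ s, tensorMat (c • (w x.1 * star (w x.2))) (A x.1 x.2) ∈
      cstarCones 𝒜 p) :
    tensorMat (1 : ℬ) A₁₁ +
      ∑ x ∈ s, tensorMat (c • (φ (w x.1) * star (φ (w x.2)))) (A x.1 x.2) ∈ cstarCones ℬ p := by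
  have h1 := map_mem_cstarCones φ h
  have h2 := tensorMat_combination_map φ.toAlgHom.toLinearMap (1 : 𝒜) A₁₁ s
    (fun x => c • (w x.1 * star (w x.2))) (fun x => A x.1 x.2)
  have h3 : ∀ x, φ.toAlgHom.toLinearMap x = φ x := fun _ => rfl
  simp only [h3, map_smul, map_mul, map_star, map_one] at h2
  rw [← h2]
  exact h1

/-- Positivity over `C*(F_{n-1})` passes to all compressions, by dilation to unitaries. -/
theorem compress_mem_of_cstar {n p : ℕ} (hn : n ≠ 0) {A₁₁ : Matrix (Fin p) (Fin p) ℂ}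
    {A : Fin n → Fin n → Matrix (Fin p) (Fin p) ℂ}
    (h : tensorMat (1 : FreeCStar n) A₁₁
          + ∑ x ∈ (Finset.univ : Finset (Fin n)).offDiag,
              tensorMat ((1 / (n : ℂ)) • (freeUnitary n x.1 * star (freeUnitary n x.2)))
                (A x.1 x.2)
        ∈ cstarCones (FreeCStar n) p) {r : ℕ} (C : Fin n → Fin n → Matrix (Fin r) (Fin r) ℂ)
    (hC : blockWithDiag 1 C ∈ matCones r n) :
    tensorMat 1 A₁₁
            + ∑ x ∈ (Finset.univ : Finset (Fin n)).offDiag,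
                tensorMat ((1 / (n : ℂ)) • C x.1 x.2) (A x.1 x.2)
          ∈ matCones r p := by
  -- For `r = 0` the dilation space is zero and is not an admissible `UnitaryRep`.
  rcases Nat.eq_zero_or_pos r with rfl | hr
  · rw [mem_matCones]
    convert Matrix.PosSemidef.zero
    ext x
    exact x.2.elim0
  obtain ⟨u, v, hu₀, huv⟩ := exists_unitary_dilation ⟨0, Nat.pos_of_ne_zero hn⟩ hC
  have : Nonempty (Fin n × Fin r) := ⟨(⟨0, Nat.pos_of_ne_zero hn⟩, ⟨0, hr⟩)⟩
  -- Adjoints are used so that `w_i w_j*` goes to `u_i* u_j`, whose compression is `C_ij`. Generator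
  -- `k` corresponds to index `k + 1`, index `0` being the unit.
  let ρ : UnitaryRep (FreeGroup (Fin (n - 1))) :=
    { H := EuclideanSpace ℂ (Fin n × Fin r)
      π := FreeGroup.lift fun k => star (u ⟨(k : ℕ) + 1, by omega⟩) }
  have hρ : ∀ i, FullGroupCStar.lift ρ (freeUnitary n i) = star (u i : ρ.H →L[ℂ] ρ.H) := by
    intro i
    rw [freeUnitary_eq, FullGroupCStar.lift_groupUnitary]
    unfold freeIndex
    split
    · rename_i h0
      have : i = ⟨0, Nat.pos_of_ne_zero hn⟩ := Fin.ext h0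
      rw [this, hu₀]
      simp
    · rename_i h0
      have : (⟨(i : ℕ) - 1 + 1, by omega⟩ : Fin n) = i := Fin.ext (by simp; omega)
      simp only [ρ, FreeGroup.lift_apply_of, this]
      rfl
  have hZ : tensorMat (1 : ρ.H →L[ℂ] ρ.H) A₁₁ + ∑ x ∈ (Finset.univ : Finset (Fin n)).offDiag,
      tensorMat ((1 / (n : ℂ)) • (star (u x.1 : ρ.H →L[ℂ] ρ.H) * (u x.2 : ρ.H →L[ℂ] ρ.H)))
        (A x.1 x.2) ∈ cstarCones (ρ.H →L[ℂ] ρ.H) p := by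
    have h1 := combination_mul_star_mem_cstarCones (FullGroupCStar.lift ρ) _ h
    simpa only [hρ, star_star] using h1
  obtain ⟨Y, hY⟩ := hZ
  have key := posSemidef_inner_of_eq_conjTranspose_mul_self hY v
  rw [mem_matCones]
  convert key using 1
  have huv' : ∀ x ∈ (Finset.univ : Finset (Fin n)).offDiag, ∀ s t,
      inner ℂ (v s) (star (u x.1).val ((u x.2).val (v t))) = C x.1 x.2 s t := fun x hx s t => by
    rw [ContinuousLinearMap.star_eq_adjoint, ContinuousLinearMap.adjoint_inner_right, huv]
    simp [blockWithDiag, (Finset.mem_offDiag.mp hx).2.2]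
  have hv : ∀ s t, inner ℂ (v s) (v t) = (1 : Matrix (Fin r) (Fin r) ℂ) s t := fun s t => by
    have := huv ⟨0, Nat.pos_of_ne_zero hn⟩ ⟨0, Nat.pos_of_ne_zero hn⟩ s t
    rw [hu₀] at this
    simpa [blockWithDiag] using this
  ext x y
  simp only [Matrix.of_apply, Matrix.add_apply, Matrix.sum_apply, tensorMat_apply,
    Matrix.smul_apply, _root_.add_apply, _root_.sum_apply,
    _root_.smul_apply, _root_.one_apply_eq_self, _root_.mul_apply_eq_comp,
    inner_add_right, inner_sum, inner_smul_right, smul_eq_mul]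
  congr 1
  · exact congr_arg _ (hv _ _).symm
  · refine Finset.sum_congr rfl fun z hz => ?_
    rw [← huv' z hz]

/-! ### Closedness of the cone of completable data -/

open scoped MatrixOrder Matrix.Norms.L2Operator in
theorem Matrix.IsHermitian.exists_posSemidef_add_smul_one {ι : Type*} [Fintype ι] [DecidableEq ι]
    {K : Matrix ι ι ℂ} (hK : K.IsHermitian) :
    ∃ c : ℝ, (K + (c : ℂ) • (1 : Matrix ι ι ℂ)).PosSemidef := by
  refine ⟨‖K‖, Matrix.nonneg_iff_posSemidef.1 ?_⟩
  have h := IsSelfAdjoint.neg_algebraMap_norm_le_self (a := K) hK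
  rw [neg_le_iff_add_nonneg] at h
  convert h using 2
  rw [Algebra.algebraMap_eq_smul_one]
  rfl

/-- Entries of a Gram matrix are inner products of columns, bounded by the mean of two squared
norms, each at most the trace. A trace bound thus confines positive matrices to a compact set. -/
theorem Matrix.PosSemidef.norm_apply_le_trace {ι : Type*} [Fintype ι] {P : Matrix ι ι ℂ}
    (hP : P.PosSemidef) (x y : ι) : ‖P x y‖ ≤ P.trace.re := by
  obtain ⟨S, rfl⟩ := hP.exists_eq_conjTranspose_mul_self
  have hd : ∀ z, ((Sᴴ * S) z z).re = ∑ c, ‖S c z‖ ^ 2 := fun z => by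
    simp [Matrix.mul_apply, ← Complex.normSq_eq_norm_sq, Complex.normSq_apply]
  have htr : (Sᴴ * S).trace.re = ∑ z, ∑ c, ‖S c z‖ ^ 2 := by
    simp only [Matrix.trace, Complex.re_sum, Matrix.diag_apply, hd]
  have hle : ∀ z, ∑ c, ‖S c z‖ ^ 2 ≤ (Sᴴ * S).trace.re := fun z => by
    rw [htr]
    exact Finset.single_le_sum (f := fun z => ∑ c, ‖S c z‖ ^ 2)
      (fun i _ => Finset.sum_nonneg fun c _ => by positivity) (Finset.mem_univ z)
  calc ‖(Sᴴ * S) x y‖ ≤ ∑ c, ‖S c x‖ * ‖S c y‖ := by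
        rw [Matrix.mul_apply]
        refine (norm_sum_le _ _).trans (le_of_eq ?_)
        simp
    _ ≤ ∑ c, (‖S c x‖ ^ 2 + ‖S c y‖ ^ 2) / 2 := Finset.sum_le_sum fun c _ => by
        nlinarith [sq_nonneg (‖S c x‖ - ‖S c y‖)]
    _ = (∑ c, ‖S c x‖ ^ 2 + ∑ c, ‖S c y‖ ^ 2) / 2 := by
        rw [← Finset.sum_div, Finset.sum_add_distrib]
    _ ≤ (Sᴴ * S).trace.re := by linarith [hle x, hle y]

theorem Matrix.isClosed_setOf_posSemidef {ι : Type*} [Fintype ι] :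
    IsClosed {P : Matrix ι ι ℂ | P.PosSemidef} := by
  have : {P : Matrix ι ι ℂ | P.PosSemidef} =
      {P | Pᴴ = P} ∩ ⋂ x : ι → ℂ, {P | 0 ≤ star x ⬝ᵥ P *ᵥ x} := by
    ext P
    simp [Matrix.posSemidef_iff_dotProduct_mulVec, Matrix.IsHermitian]
  rw [this]
  refine (isClosed_eq (by fun_prop) continuous_id).inter (isClosed_iInter fun x => ?_)
  exact isClosed_le continuous_const (by fun_prop)

/-- The linear map that keeps the off-diagonal blocks and replaces each diagonal block by the sum
of the diagonal blocks. -/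
def sumDiagBlocks (p n : ℕ) :
    Matrix (Fin p × Fin n) (Fin p × Fin n) ℂ →ₗ[ℂ] Matrix (Fin p × Fin n) (Fin p × Fin n) ℂ where
  toFun X := Matrix.of fun x y => if x.2 = y.2 then ∑ k, X (x.1, k) (y.1, k) else X x y
  map_add' X Y := by
    ext x y
    by_cases h : x.2 = y.2 <;> simp [h, Finset.sum_add_distrib]
  map_smul' c X := by
    ext x y
    by_cases h : x.2 = y.2 <;> simp [h, Finset.mul_sum]

theorem sumDiagBlocks_apply {p n : ℕ} (X : Matrix (Fin p × Fin n) (Fin p × Fin n) ℂ)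
    (x y : Fin p × Fin n) : sumDiagBlocks p n X x y =
      if x.2 = y.2 then ∑ k, X (x.1, k) (y.1, k) else X x y := rfl

theorem sum_sumDiagBlocks_apply {p n : ℕ} (X : Matrix (Fin p × Fin n) (Fin p × Fin n) ℂ)
    (i : Fin n) : ∑ a, sumDiagBlocks p n X (a, i) (a, i) = X.trace := by
  simp [sumDiagBlocks_apply, Matrix.trace, Fintype.sum_prod_type]

-- A linear image of a closed cone need not be closed. Here the image determines the trace of a
-- preimage, so positive preimages of a convergent sequence are bounded and subconverge to a
-- preimage of the limit. The index `i` selects a diagonal block from which the trace is read.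
open scoped Matrix.Norms.Elementwise in
theorem isClosed_sumDiagBlocks_image {p n : ℕ} (i : Fin n) :
    IsClosed (sumDiagBlocks p n '' {P | P.PosSemidef}) := by
  have hcont : Continuous (sumDiagBlocks p n) := LinearMap.continuous_of_finiteDimensional _
  have : ProperSpace (Matrix (Fin p × Fin n) (Fin p × Fin n) ℂ) := FiniteDimensional.proper ℂ _
  have : FirstCountableTopology (Matrix (Fin p × Fin n) (Fin p × Fin n) ℂ) :=
    inferInstanceAs (FirstCountableTopology (Fin p × Fin n → Fin p × Fin n → ℂ))
  refine IsSeqClosed.isClosed fun Z z hZ hz => ?_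
  choose P hP hPZ using hZ
  have htr : Filter.Tendsto (fun m => (P m).trace.re) Filter.atTop
      (nhds (∑ a, z (a, i) (a, i)).re) := by
    have hc : Continuous fun X : Matrix (Fin p × Fin n) (Fin p × Fin n) ℂ =>
        (∑ a, X (a, i) (a, i)).re := by fun_prop
    refine ((hc.tendsto z).comp hz).congr fun m => ?_
    simp only [Function.comp_apply, ← hPZ, sum_sumDiagBlocks_apply]
  obtain ⟨c, hc⟩ := htr.bddAbove_range
  have hb : ∀ m, P m ∈ Metric.closedBall (0 : Matrix (Fin p × Fin n) (Fin p × Fin n) ℂ) c := by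
    intro m
    have hm : (P m).trace.re ≤ c := hc ⟨m, rfl⟩
    rw [mem_closedBall_zero_iff, Matrix.norm_le_iff]
    · exact fun x y => ((hP m).norm_apply_le_trace x y).trans hm
    · exact (Complex.nonneg_iff.1 (hP m).trace_nonneg).1.trans hm
  obtain ⟨Q, -, φ, hφ, hQ⟩ := tendsto_subseq_of_bounded Metric.isBounded_closedBall hb
  refine ⟨Q, Matrix.isClosed_setOf_posSemidef.mem_of_tendsto hQ
    (Filter.Eventually.of_forall fun m => hP _), ?_⟩
  refine tendsto_nhds_unique ((hcont.tendsto Q).comp hQ) ?_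
  refine (hz.comp hφ.tendsto_atTop).congr fun m => ?_
  simp [hPZ]

/-! ### Duality with constant diagonal blocks -/

/-- All diagonal blocks of a block matrix coincide. -/
def HasConstDiagBlocks {p n : ℕ} (B : Matrix (Fin p × Fin n) (Fin p × Fin n) ℂ) : Prop :=
  ∀ a b i j, B (a, i) (b, i) = B (a, j) (b, j)

theorem HasConstDiagBlocks.add {p n : ℕ} {B C : Matrix (Fin p × Fin n) (Fin p × Fin n) ℂ}
    (hB : HasConstDiagBlocks B) (hC : HasConstDiagBlocks C) : HasConstDiagBlocks (B + C) :=
  fun a b i j => by simp only [Matrix.add_apply, hB a b i j, hC a b i j]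

theorem HasConstDiagBlocks.smul {p n : ℕ} {B : Matrix (Fin p × Fin n) (Fin p × Fin n) ℂ}
    (hB : HasConstDiagBlocks B) (c : ℂ) : HasConstDiagBlocks (c • B) :=
  fun a b i j => by simp only [Matrix.smul_apply, hB a b i j]

theorem HasConstDiagBlocks.conjTranspose {p n : ℕ}
    {B : Matrix (Fin p × Fin n) (Fin p × Fin n) ℂ}
    (hB : HasConstDiagBlocks B) : HasConstDiagBlocks Bᴴ :=
  fun a b i j => by simp only [Matrix.conjTranspose_apply, hB b a i j]

theorem hasConstDiagBlocks_one {p n : ℕ} :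
    HasConstDiagBlocks (1 : Matrix (Fin p × Fin n) (Fin p × Fin n) ℂ) :=
  fun a b i j => by simp [Matrix.one_apply]

/-- The bilinear pairing `∑ X_xy G_xy` of square matrices. -/
def entrySum {ι : Type*} [Fintype ι] (X G : Matrix ι ι ℂ) : ℂ := ∑ x, ∑ y, X x y * G x y

theorem entrySum_add {ι : Type*} [Fintype ι] (X G H : Matrix ι ι ℂ) :
    entrySum X (G + H) = entrySum X G + entrySum X H := by
  simp [entrySum, mul_add, Finset.sum_add_distrib]

theorem entrySum_smul {ι : Type*} [Fintype ι] (X G : Matrix ι ι ℂ) (c : ℂ) :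
    entrySum X (c • G) = c * entrySum X G := by
  simp [entrySum, Finset.mul_sum, mul_left_comm]

theorem entrySum_conjTranspose {ι : Type*} [Fintype ι] {X : Matrix ι ι ℂ} (hX : X.IsHermitian)
    (G : Matrix ι ι ℂ) : entrySum X Gᴴ = star (entrySum X G) := by
  simp only [entrySum, star_sum, star_mul']
  rw [Finset.sum_comm]
  refine Finset.sum_congr rfl fun x _ => Finset.sum_congr rfl fun y _ => ?_
  rw [hX.apply, Matrix.conjTranspose_apply]

/-- Duality between the positive semidefinite block matrices with prescribed off-diagonal blocks
and sum of diagonal blocks and those with constant diagonal blocks. -/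
theorem exists_posSemidef_sumDiagBlocks_eq {p n : ℕ} (i₀ : Fin n)
    {X : Matrix (Fin p × Fin n) (Fin p × Fin n) ℂ}
    (hX : ∀ B : Matrix (Fin p × Fin n) (Fin p × Fin n) ℂ, B.PosSemidef → HasConstDiagBlocks B →
      0 ≤ entrySum X B) :
    ∃ P : Matrix (Fin p × Fin n) (Fin p × Fin n) ℂ, P.PosSemidef ∧
      sumDiagBlocks p n P = sumDiagBlocks p n X := by
  by_contra hcon
  have : LocallyConvexSpace ℝ (Matrix (Fin p × Fin n) (Fin p × Fin n) ℂ) :=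
    inferInstanceAs (LocallyConvexSpace ℝ (Fin p × Fin n → Fin p × Fin n → ℂ))
  have hconv : Convex ℝ (sumDiagBlocks p n '' {P | P.PosSemidef}) := by
    rintro _ ⟨P, hP, rfl⟩ _ ⟨Q, hQ, rfl⟩ s t hs ht -
    refine ⟨(s : ℂ) • P + (t : ℂ) • Q, ?_, ?_⟩
    · exact (hP.smul (by exact_mod_cast hs)).add (hQ.smul (by exact_mod_cast ht))
    · rw [map_add, map_smul, map_smul]
      rfl
  obtain ⟨f, u, hfu, huf⟩ := RCLike.geometric_hahn_banach_point_closed (𝕜 := ℂ) hconv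
    (isClosed_sumDiagBlocks_image i₀) (x := sumDiagBlocks p n X)
    (by rintro ⟨P, hP, h⟩; exact hcon ⟨P, hP, h⟩)
  have hu : u < 0 := by
    have := huf 0 ⟨0, Matrix.PosSemidef.zero, map_zero _⟩
    simpa using this
  -- A negative value could be scaled to equal `u` exactly, against the strict separation.
  have hnonneg : ∀ P : Matrix (Fin p × Fin n) (Fin p × Fin n) ℂ, P.PosSemidef →
      0 ≤ (f (sumDiagBlocks p n P)).re := by
    intro P hP
    by_contra! hneg
    have ht : 0 ≤ u / (f (sumDiagBlocks p n P)).re :=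
      div_nonneg_of_nonpos hu.le hneg.le
    have := huf _ ⟨((u / (f (sumDiagBlocks p n P)).re : ℝ) : ℂ) • P,
      hP.smul (by exact_mod_cast ht), rfl⟩
    rw [map_smul, map_smul, smul_eq_mul] at this
    simp only [RCLike.re_to_complex, Complex.re_ofReal_mul] at this
    rw [div_mul_cancel₀ _ hneg.ne] at this
    exact lt_irrefl _ this
  let G : Matrix (Fin p × Fin n) (Fin p × Fin n) ℂ :=
    Matrix.of fun x y => f (sumDiagBlocks p n (Matrix.single x y 1))
  have hG : ∀ Y, f (sumDiagBlocks p n Y) = entrySum Y G := fun Y => by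
    conv_lhs => rw [Matrix.matrix_eq_sum_single Y]
    simp only [map_sum, entrySum, G, Matrix.of_apply]
    refine Finset.sum_congr rfl fun x _ => Finset.sum_congr rfl fun y _ => ?_
    rw [← smul_eq_mul, ← map_smul, ← map_smul, Matrix.smul_single, smul_eq_mul, mul_one]
  -- A matrix unit at `((a, i), (b, i))` has an image under `sumDiagBlocks` independent of `i`.
  have hGd : HasConstDiagBlocks G := fun a b i j => by
    simp only [G, Matrix.of_apply]
    congr 1
    ext x y
    simp only [sumDiagBlocks_apply, Matrix.single_apply]
    by_cases h : x.2 = y.2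
    · simp [h, Prod.ext_iff, ite_and]
    · simp only [h, if_false, Prod.ext_iff]
      rw [if_neg, if_neg] <;> grind
  -- `f` is complex linear and need not be real on Hermitian matrices, so `G` is split as `H + iK`
  -- with `H` and `K` Hermitian.
  let H := (1 / 2 : ℂ) • (G + Gᴴ)
  let K := (-Complex.I / 2) • (G + (-1 : ℂ) • Gᴴ)
  have hHd : HasConstDiagBlocks H := (hGd.add hGd.conjTranspose).smul _
  have hKd : HasConstDiagBlocks K := (hGd.add (hGd.conjTranspose.smul _)).smul _
  have hGHK : G = H + Complex.I • K := by
    ext x y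
    simp only [H, K, Matrix.add_apply, Matrix.smul_apply, smul_eq_mul]
    linear_combination ((1 / 2 : ℂ) * (G x y - Gᴴ x y)) * Complex.I_sq
  have hHh : H.IsHermitian := by
    ext x y
    simp [H, add_comm]
  have hKh : K.IsHermitian := by
    ext x y
    simp [K]
    ring
  have hH : ∀ Y : Matrix (Fin p × Fin n) (Fin p × Fin n) ℂ, Y.IsHermitian →
      entrySum Y H = ((entrySum Y G).re : ℂ) := fun Y hY => by
    simp only [H, entrySum_smul, entrySum_add, entrySum_conjTranspose hY, Complex.star_def,
      Complex.add_conj]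
    push_cast
    ring
  have hHpos : H.PosSemidef := by
    refine .of_dotProduct_mulVec_nonneg hHh fun v => ?_
    have hP := Matrix.posSemidef_vecMulVec_star_self (R := ℂ) v
    have h1 : star v ⬝ᵥ H *ᵥ v = entrySum (Matrix.vecMulVec (star v) v) H := by
      simp only [dotProduct, Matrix.mulVec, entrySum, Matrix.vecMulVec_apply, Finset.mul_sum]
      refine Finset.sum_congr rfl fun x _ => Finset.sum_congr rfl fun y _ => ?_
      ring
    rw [h1, hH _ hP.1, ← hG]
    exact_mod_cast hnonneg _ hP
  -- `X` is not assumed Hermitian; the pairing with `K` is real because `K` is a difference of the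
  -- positive matrices `K + c 1` and `c 1` up to the sign of `c`, both with constant diagonal
  -- blocks.
  have hKreal : (entrySum X K).im = 0 := by
    obtain ⟨c, hc⟩ := hKh.exists_posSemidef_add_smul_one
    have h1 := hX _ hc (hKd.add (hasConstDiagBlocks_one.smul _))
    have h2 := hX _ Matrix.PosSemidef.one hasConstDiagBlocks_one
    rw [entrySum_add, entrySum_smul X 1] at h1
    have h3 := (Complex.nonneg_iff.1 h1).2
    have h4 := (Complex.nonneg_iff.1 h2).2
    simp only [Complex.add_im, Complex.im_ofReal_mul, ← h4, mul_zero, add_zero] at h3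
    exact h3.symm
  have hXH := (Complex.nonneg_iff.1 (hX H hHpos hHd)).1
  have : (f (sumDiagBlocks p n X)).re = (entrySum X H).re := by
    rw [hG, hGHK, entrySum_add, entrySum_smul X K]
    simp [hKreal]
  rw [RCLike.re_to_complex, this] at hfu
  linarith

/-! ### From compressions to the scalar pairing -/

/-- The test vector is `S` read as a vector. For `C = S⁻¹* B S⁻¹` the right side is the pairing with
`B`, so the normalisation is undone by the choice of vector. -/
theorem dotProduct_kronecker_mulVec {ι κ : Type*} [Fintype ι] [Fintype κ] (R : Matrix ι ι ℂ)
    (C : Matrix κ κ ℂ) (S : Matrix κ ι ℂ) :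
    star (fun x : ι × κ => S x.2 x.1) ⬝ᵥ Matrix.kronecker R C *ᵥ (fun x => S x.2 x.1) =
      entrySum R (Sᴴ * C * S) := by
  simp only [dotProduct, Matrix.mulVec, Fintype.sum_prod_type, entrySum, Matrix.mul_apply,
    Matrix.kronecker, Matrix.kroneckerMap_apply, Pi.star_apply, Matrix.conjTranspose_apply,
    Finset.mul_sum, Finset.sum_mul]
  refine Finset.sum_congr rfl fun a _ => ?_
  rw [Finset.sum_comm]
  refine Finset.sum_congr rfl fun b _ => ?_
  rw [Finset.sum_comm]
  refine Finset.sum_congr rfl fun d _ => Finset.sum_congr rfl fun c _ => ?_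
  ring

theorem entrySum_eq_sum_blocks {α ι : Type*} [Fintype α] [Fintype ι]
    (R : ι → ι → Matrix α α ℂ) (B : Matrix (α × ι) (α × ι) ℂ) :
    entrySum (Matrix.of fun x y : α × ι => R x.2 y.2 x.1 y.1) B =
      ∑ i, ∑ j, entrySum (R i j) (Matrix.of fun a b => B (a, i) (b, j)) := by
  simp only [entrySum, Fintype.sum_prod_type, Matrix.of_apply]
  rw [Finset.sum_comm]
  refine Finset.sum_congr rfl fun i _ => ?_
  conv_rhs => rw [Finset.sum_comm]
  refine Finset.sum_congr rfl fun a _ => ?_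
  rw [Finset.sum_comm]

/-- A compression condition on all block matrices with identity diagonal blocks implies
nonnegativity of the pairing with all block matrices with constant diagonal blocks. -/
theorem entrySum_nonneg_of_compress {n p : ℕ} (hn : n ≠ 0)
    {R : Fin n → Fin n → Matrix (Fin p) (Fin p) ℂ}
    (h : ∀ C : Fin n → Fin n → Matrix (Fin p) (Fin p) ℂ, (∀ i, C i i = 1) →
      (Matrix.of C) ∈ matCones p n →
      ∑ i, ∑ j, tensorMat ((1 / (n : ℂ)) • C i j) (R i j) ∈ matCones p p)
    {B : Matrix (Fin p × Fin n) (Fin p × Fin n) ℂ} (hB : B.PosSemidef)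
    (hBd : HasConstDiagBlocks B) :
    0 ≤ entrySum (Matrix.of fun x y : Fin p × Fin n => R x.2 y.2 x.1 y.1) B := by
  -- The common diagonal block may be singular; adding `ε` makes it invertible, and `ε → 0` at the
  -- end.
  let D : ℝ → Matrix (Fin p) (Fin p) ℂ := fun ε =>
    B.submatrix (fun a => (a, ⟨0, Nat.pos_of_ne_zero hn⟩)) (fun a => (a, ⟨0, Nat.pos_of_ne_zero hn⟩))
      + (ε : ℂ) • 1
  let X := Matrix.of fun x y : Fin p × Fin n => R x.2 y.2 x.1 y.1
  have key : ∀ ε : ℝ, 0 < ε → 0 ≤ entrySum X (B + (ε : ℂ) • 1) := by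
    intro ε hε
    have hεc : (0 : ℂ) < ε := by exact_mod_cast hε
    have hB' : (B + (ε : ℂ) • 1).PosSemidef := hB.add (Matrix.PosSemidef.one.smul hεc.le)
    have hDp : (D ε).PosDef := Matrix.PosDef.posSemidef_add (hB.submatrix _)
      (Matrix.PosDef.one.smul hεc)
    obtain ⟨S, hS⟩ := hDp.posSemidef.exists_eq_conjTranspose_mul_self
    have hSu : IsUnit S.det := by
      have := (Matrix.isUnit_iff_isUnit_det _).1 hDp.isUnit
      rw [hS, Matrix.det_mul] at this
      exact isUnit_of_mul_isUnit_right this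
    let B' : Fin n → Fin n → Matrix (Fin p) (Fin p) ℂ := fun i j =>
      Matrix.of fun a b => (B + (ε : ℂ) • 1) (a, i) (b, j)
    have hB'd : ∀ i, B' i i = Sᴴ * S := fun i => by
      rw [← hS]
      ext a b
      simp [B', D, Matrix.one_apply, hBd a b i ⟨0, Nat.pos_of_ne_zero hn⟩]
    -- With `D ε = S* S`, this conjugation makes every diagonal block the identity.
    have hC := h (fun i j => S⁻¹ᴴ * B' i j * S⁻¹) (fun i => ?_) ?_
    · rw [mem_matCones] at hC
      have hω := hC.dotProduct_mulVec_nonneg fun x => S x.2 x.1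
      have hsum : (Matrix.of fun x y : Fin p × Fin p => (∑ i, ∑ j,
          tensorMat ((1 / (n : ℂ)) • (S⁻¹ᴴ * B' i j * S⁻¹)) (R i j)) x.1 y.1 x.2 y.2) =
          ∑ i, ∑ j, (1 / (n : ℂ)) • Matrix.kronecker (R i j) (S⁻¹ᴴ * B' i j * S⁻¹) := by
        ext x y
        simp [Matrix.sum_apply, tensorMat_apply, mul_left_comm]
      have hcancel : ∀ i j, Sᴴ * (S⁻¹ᴴ * B' i j * S⁻¹) * S = B' i j := fun i j => by
        rw [Matrix.mul_assoc, Matrix.mul_assoc, Matrix.mul_assoc, Matrix.nonsing_inv_mul _ hSu,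
          mul_one, ← Matrix.mul_assoc, ← Matrix.conjTranspose_mul, Matrix.nonsing_inv_mul _ hSu,
          Matrix.conjTranspose_one, one_mul]
      rw [hsum] at hω
      simp only [Matrix.sum_mulVec, dotProduct_sum, Matrix.smul_mulVec, dotProduct_smul,
        dotProduct_kronecker_mulVec, hcancel, smul_eq_mul, ← Finset.mul_sum] at hω
      rw [entrySum_eq_sum_blocks]
      have hn' : (n : ℂ) ≠ 0 := Nat.cast_ne_zero.mpr hn
      have hω' := mul_nonneg (Nat.cast_nonneg (α := ℂ) n) hω
      rwa [← mul_assoc, mul_one_div_cancel hn', one_mul] at hω'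
    · simp only [hB'd]
      rw [Matrix.mul_assoc, Matrix.mul_assoc, Matrix.mul_nonsing_inv _ hSu, mul_one,
        ← Matrix.conjTranspose_mul, Matrix.mul_nonsing_inv _ hSu, Matrix.conjTranspose_one]
    · rw [mem_matCones]
      -- The normalised block matrix is the conjugate of `B + ε 1`, indices swapped, by `1 ⊗ S⁻¹`.
      convert (hB'.submatrix Prod.swap).conjTranspose_mul_mul_same
        (Matrix.kronecker (1 : Matrix (Fin n) (Fin n) ℂ) S⁻¹) using 1
      ext x y
      simp [Matrix.mul_apply, Fintype.sum_prod_type, Matrix.one_apply, B', Finset.sum_mul,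
        apply_ite star, ite_mul, mul_ite]
      refine Finset.sum_congr rfl fun j _ => Finset.sum_congr rfl fun i _ => ?_
      simp [and_comm]
  have hlim : Filter.Tendsto (fun ε : ℝ => entrySum X (B + (ε : ℂ) • 1))
      (nhdsWithin 0 (Set.Ioi 0)) (nhds (entrySum X B)) := by
    simp only [entrySum_add, entrySum_smul]
    have : Continuous fun ε : ℝ => entrySum X B + (ε : ℂ) * entrySum X 1 := by fun_prop
    simpa using (this.tendsto 0).mono_left nhdsWithin_le_nhds
  exact ge_of_tendsto hlim (eventually_nhdsWithin_of_forall fun ε hε => key ε hε)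

/-! ### Completions and the equivalence -/

theorem blockWithDiag_eq_of {n r : ℕ} {D : Matrix (Fin r) (Fin r) ℂ}
    {B : Fin n → Fin n → Matrix (Fin r) (Fin r) ℂ} (h : ∀ i, B i i = D) :
    blockWithDiag D B = Matrix.of B := by
  ext i j : 2
  by_cases hij : i = j
  · subst hij; simp [blockWithDiag, h]
  · simp [blockWithDiag, hij]

theorem smul_mem_matCones {r k : ℕ} {X : Matrix (Fin k) (Fin k) (Matrix (Fin r) (Fin r) ℂ)}
    (hX : X ∈ matCones r k) {c : ℂ} (hc : 0 ≤ c) : c • X ∈ matCones r k :=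
  Matrix.PosSemidef.smul (mem_matCones.1 hX) hc

/-- The existence of a positive completion, from the compression condition. -/
theorem exists_completion_of_compress {n p : ℕ} (hn : n ≠ 0) {A₁₁ : Matrix (Fin p) (Fin p) ℂ}
    {A : Fin n → Fin n → Matrix (Fin p) (Fin p) ℂ}
    (h : ∀ C : Fin n → Fin n → Matrix (Fin p) (Fin p) ℂ, blockWithDiag 1 C ∈ matCones p n →
      tensorMat 1 A₁₁ + ∑ x ∈ (Finset.univ : Finset (Fin n)).offDiag,
        tensorMat ((1 / (n : ℂ)) • C x.1 x.2) (A x.1 x.2) ∈ matCones p p) :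
    ∃ R : Fin n → Fin n → Matrix (Fin p) (Fin p) ℂ,
      (∀ i j, i ≠ j → R i j = A i j) ∧ ∑ i, R i i = (n : ℂ) • A₁₁ ∧
      ∑ i, ∑ j, tensorMat (Matrix.single i j (1 : ℂ)) (R i j) ∈ matCones n p := by
  -- Any diagonal with sum `n A₁₁` would do; this lift need not be positive.
  let R : Fin n → Fin n → Matrix (Fin p) (Fin p) ℂ := fun i j => if i = j then A₁₁ else A i j
  have hR : ∀ i j, i ≠ j → R i j = A i j := fun i j hij => if_neg hij
  have hsum : ∑ i, R i i = (n : ℂ) • A₁₁ := by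
    simp [R, ← Nat.cast_smul_eq_nsmul ℂ]
  have i₀ : Fin n := ⟨0, Nat.pos_of_ne_zero hn⟩
  obtain ⟨P, hP, hPR⟩ := exists_posSemidef_sumDiagBlocks_eq i₀ fun B hB hBd =>
    entrySum_nonneg_of_compress hn (R := R) (fun C hC1 hC => by
      rw [sum_tensorMat_eq hn (e := 1) (fun i => by rw [hC1]) hR hsum]
      exact h C (by rwa [blockWithDiag_eq_of hC1])) hB hBd
  have hPR' := fun a b i j => congr_fun (congr_fun hPR (a, i)) (b, j)
  simp only [sumDiagBlocks_apply, Matrix.of_apply] at hPR'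
  refine ⟨fun i j => Matrix.of fun a b => P (a, i) (b, j), fun i j hij => ?_, ?_, ?_⟩
  · ext a b
    have := hPR' a b i j
    rw [if_neg hij, if_neg hij, hR i j hij] at this
    exact this
  · ext a b
    have := hPR' a b i₀ i₀
    rw [if_pos rfl, if_pos rfl] at this
    rw [← hsum]
    simpa [Matrix.sum_apply] using this
  · rw [sum_sum_single_mem_matCones]
    exact hP

/-- A positive completion represents a positive element of the quotient operator system. -/
theorem mem_matQuotCones_of_completion {n p : ℕ} (hn : n ≠ 0) {A₁₁ : Matrix (Fin p) (Fin p) ℂ}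
    {A R : Fin n → Fin n → Matrix (Fin p) (Fin p) ℂ} (hR : ∀ i j, i ≠ j → R i j = A i j)
    (hsum : ∑ i, R i i = (n : ℂ) • A₁₁)
    (hpos : ∑ i, ∑ j, tensorMat (Matrix.single i j (1 : ℂ)) (R i j) ∈ matCones n p) :
    tensorMat (matQuotOne n) A₁₁ + ∑ x ∈ (Finset.univ : Finset (Fin n)).offDiag,
      tensorMat (matQuotUnit n x.1 x.2) (A x.1 x.2) ∈ matQuotCones n p := by
  rw [← sum_tensorMat_eq hn (v := matQuotUnit n) (matQuotUnit_self hn) hR hsum]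
  -- The completion is itself a positive lift, so `K = 0` serves for every `ε`.
  refine ⟨∑ i, ∑ j, tensorMat (Matrix.single i j (1 : ℂ)) (R i j), ?_, ?_, fun ε hε =>
    ⟨0, Matrix.isHermitian_zero, fun _ _ => Submodule.zero_mem _, ?_⟩⟩
  · ext a b i j
    exact congr_fun (congr_fun (mem_matCones.1 hpos).1 (a, i)) (b, j)
  · ext a b
    simp only [Matrix.map_apply, Matrix.sum_apply, tensorMat_apply, map_sum, map_smul, matQuotUnit]
  · rw [add_zero, mem_matCones]
    have h1 : ((ε : ℂ) • (1 : Matrix (Fin p × Fin n) (Fin p × Fin n) ℂ)).PosSemidef :=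
      Matrix.PosSemidef.one.smul (by exact_mod_cast hε.le)
    convert h1.add (mem_matCones.1 hpos) using 1
    ext x y
    simp only [Matrix.add_apply, Matrix.of_apply, tensorMat_apply, Matrix.smul_apply,
      Matrix.one_apply, Prod.ext_iff]
    by_cases h1 : x.1 = y.1 <;> by_cases h2 : x.2 = y.2 <;> simp [h1, h2]

/-- A positive completion makes the combination with `w_i w_j*` positive, for unitaries `w_i`. -/
theorem mem_cstarCones_of_completion {𝒜 : Type*} [CStarAlgebra 𝒜] {n p : ℕ} (hn : n ≠ 0)
    {A₁₁ : Matrix (Fin p) (Fin p) ℂ} {A R : Fin n → Fin n → Matrix (Fin p) (Fin p) ℂ}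
    (hR : ∀ i j, i ≠ j → R i j = A i j) (hsum : ∑ i, R i i = (n : ℂ) • A₁₁)
    (hpos : ∑ i, ∑ j, tensorMat (Matrix.single i j (1 : ℂ)) (R i j) ∈ matCones n p)
    {w : Fin n → 𝒜} (hw : ∀ i, w i * star (w i) = 1) :
    tensorMat (1 : 𝒜) A₁₁ + ∑ x ∈ (Finset.univ : Finset (Fin n)).offDiag,
      tensorMat ((1 / (n : ℂ)) • (w x.1 * star (w x.2))) (A x.1 x.2) ∈ cstarCones 𝒜 p := by
  rw [← sum_tensorMat_eq hn (v := fun i j => (1 / (n : ℂ)) • (w i * star (w j)))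
    (fun i => congr_arg _ (hw i)) hR hsum]
  exact sum_tensorMat_mul_star_mem_cstarCones (sum_sum_single_mem_matCones.1 hpos) w

theorem liftQ_matQuotUnit {n r : ℕ}
    (ψ : Matrix (Fin n) (Fin n) ℂ →ₗ[ℂ] Matrix (Fin r) (Fin r) ℂ)
    (h : traceZeroDiag n ≤ LinearMap.ker ψ) (i j : Fin n) :
    (traceZeroDiag n).liftQ ψ h (matQuotUnit n i j) = ψ (Matrix.single i j 1) := rfl

theorem isUCP_ofChoi {n r : ℕ} (hn : n ≠ 0)
    {B : Matrix (Fin n) (Fin n) (Matrix (Fin r) (Fin r) ℂ)} (hB : B ∈ matCones r n)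
    (hd : ∀ i, B i i = (1 / (n : ℂ)) • 1) :
    IsUCP (matCones n) 1 (matCones r) 1 (ofChoi B) := by
  refine ⟨isCompletelyPositive_of_choi hB (ofChoi_apply _), ?_⟩
  rw [one_eq_sum_single n, map_sum]
  simp only [ofChoi_single, hd]
  rw [Finset.sum_const, Finset.card_univ, Fintype.card_fin, ← Nat.cast_smul_eq_nsmul ℂ,
    smul_smul, mul_one_div_cancel (Nat.cast_ne_zero.mpr hn), one_smul]

theorem sum_tensorMat_single_eq {n p : ℕ} {A₀ : Matrix (Fin p) (Fin p) ℂ}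
    {B : Fin n → Matrix (Fin p) (Fin p) ℂ} {A R : Fin n → Fin n → Matrix (Fin p) (Fin p) ℂ}
    (hR : ∀ i j, i ≠ j → R i j = A i j) (hd : ∀ i, R i i = A₀ + B i) :
    ∑ i, ∑ j, tensorMat (Matrix.single i j (1 : ℂ)) (R i j) =
      tensorMat (1 : Matrix (Fin n) (Fin n) ℂ) A₀
        + ∑ i, tensorMat (Matrix.single i i (1 : ℂ)) (B i)
        + ∑ x ∈ (Finset.univ : Finset (Fin n)).offDiag,
            tensorMat (Matrix.single x.1 x.2 (1 : ℂ)) (A x.1 x.2) := by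
  rw [← sum_offDiag_add_sum_diag]
  congr 1
  · ext a b : 2
    simp only [hd, one_eq_sum_single, tensorMat_apply, Matrix.sum_apply, Matrix.add_apply,
      add_smul, Finset.sum_add_distrib, Finset.smul_sum]
  · exact Finset.sum_congr rfl fun x hx => by rw [hR _ _ (Finset.mem_offDiag.mp hx).2.2]


end

theorem mainTheorem7 (n p : ℕ) (hn : 2 ≤ n) (A₁₁ : Matrix (Fin p) (Fin p) ℂ)
    (A : Fin n → Fin n → Matrix (Fin p) (Fin p) ℂ) :
    List.TFAE [
      tensorMat (matQuotOne n) A₁₁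
          + ∑ x ∈ (Finset.univ : Finset (Fin n)).offDiag,
              tensorMat (matQuotUnit n x.1 x.2) (A x.1 x.2)
        ∈ matQuotCones n p,
      ∀ (r : ℕ) (ψ : MatQuot n →ₗ[ℂ] Matrix (Fin r) (Fin r) ℂ),
        IsUCP (matQuotCones n) (matQuotOne n) (matCones r) 1 ψ →
        tensorMat 1 A₁₁
            + ∑ x ∈ (Finset.univ : Finset (Fin n)).offDiag,
                tensorMat (ψ (matQuotUnit n x.1 x.2)) (A x.1 x.2)
          ∈ matCones r p,
      ∀ (r : ℕ) (ψ : Matrix (Fin n) (Fin n) ℂ →ₗ[ℂ] Matrix (Fin r) (Fin r) ℂ),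
        IsUCP (matCones n) 1 (matCones r) 1 ψ →
        (∀ D ∈ traceZeroDiag n, ψ D = 0) →
        tensorMat 1 A₁₁
            + ∑ x ∈ (Finset.univ : Finset (Fin n)).offDiag,
                tensorMat (ψ (Matrix.single x.1 x.2 1)) (A x.1 x.2)
          ∈ matCones r p,
      ∀ (r : ℕ) (ψ : Matrix (Fin n) (Fin n) ℂ →ₗ[ℂ] Matrix (Fin r) (Fin r) ℂ),
        IsUCP (matCones n) 1 (matCones r) 1 ψ →
        (∀ i, ψ (Matrix.single i i 1) = (1 / (n : ℂ)) • 1) →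
        tensorMat 1 A₁₁
            + ∑ x ∈ (Finset.univ : Finset (Fin n)).offDiag,
                tensorMat (ψ (Matrix.single x.1 x.2 1)) (A x.1 x.2)
          ∈ matCones r p,
      ∀ (r : ℕ) (B : Fin n → Fin n → Matrix (Fin r) (Fin r) ℂ),
        blockWithDiag ((1 / (n : ℂ)) • 1) B ∈ matCones r n →
        tensorMat 1 A₁₁
            + ∑ x ∈ (Finset.univ : Finset (Fin n)).offDiag,
                tensorMat (B x.1 x.2) (A x.1 x.2)
          ∈ matCones r p,
      ∀ (r : ℕ) (C : Fin n → Fin n → Matrix (Fin r) (Fin r) ℂ),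
        blockWithDiag 1 C ∈ matCones r n →
        tensorMat 1 A₁₁
            + ∑ x ∈ (Finset.univ : Finset (Fin n)).offDiag,
                tensorMat ((1 / (n : ℂ)) • C x.1 x.2) (A x.1 x.2)
          ∈ matCones r p,
      tensorMat (1 : FreeCStar n) A₁₁
          + ∑ x ∈ (Finset.univ : Finset (Fin n)).offDiag,
              tensorMat ((1 / (n : ℂ)) • (freeUnitary n x.1 * star (freeUnitary n x.2)))
                (A x.1 x.2)
        ∈ cstarCones (FreeCStar n) p,
      ∃ B : Fin n → Matrix (Fin p) (Fin p) ℂ,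
        ∑ i, B i = ((n : ℂ) - (n : ℂ) ^ 2) • A₁₁ ∧
        tensorMat (1 : Matrix (Fin n) (Fin n) ℂ) ((n : ℂ) • A₁₁)
            + ∑ i, tensorMat (Matrix.single i i (1 : ℂ)) (B i)
            + ∑ x ∈ (Finset.univ : Finset (Fin n)).offDiag,
                tensorMat (Matrix.single x.1 x.2 (1 : ℂ)) (A x.1 x.2)
          ∈ matCones n p,
      ∃ R : Fin n → Fin n → Matrix (Fin p) (Fin p) ℂ,
        (∀ i j, i ≠ j → R i j = A i j) ∧
        ∑ i, R i i = (n : ℂ) • A₁₁ ∧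
        ∑ i, ∑ j, tensorMat (Matrix.single i j (1 : ℂ)) (R i j) ∈ matCones n p] := by
  have hn₀ : n ≠ 0 := by omega
  tfae_have 1 → 2 := fun h r ψ hψ => by
    rw [← hψ.2, ← tensorMat_combination_map]
    exact hψ.1 _ _ h
  tfae_have 2 → 3 := fun h r ψ hψ hJ => by
    have := h r ((traceZeroDiag n).liftQ ψ fun D hD => hJ D hD) (hψ.liftQ hJ)
    exact offDiag_combination_mem_congr this fun x _ => liftQ_matQuotUnit ψ _ x.1 x.2
  tfae_have 3 → 4 := fun h r ψ hψ hd => h r ψ hψ fun D hD => eq_zero_of_mem_traceZeroDiag hd hD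
  tfae_have 4 → 5 := fun h r B hB => by
    have hd : ∀ i, blockWithDiag ((1 / (n : ℂ)) • 1) B i i = (1 / (n : ℂ)) • 1 :=
      fun i => if_pos rfl
    have := h r _ (isUCP_ofChoi hn₀ hB hd)
      fun i => by rw [ofChoi_single, hd]
    simp only [ofChoi_single] at this
    exact offDiag_combination_mem_congr this fun x hx => if_neg hx
  tfae_have 5 → 6 := fun h r C hC => by
    refine h r (fun i j => (1 / (n : ℂ)) • C i j) ?_
    have h0 : (0 : ℂ) ≤ 1 / (n : ℂ) := by
      rw [one_div, ← Complex.ofReal_natCast, ← Complex.ofReal_inv]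
      exact_mod_cast inv_nonneg.2 (Nat.cast_nonneg (α := ℝ) n)
    convert smul_mem_matCones hC h0 using 1
    ext i j : 2
    by_cases hij : i = j <;> simp [blockWithDiag, hij]
  -- Compressions of size `r = p` already suffice.
  tfae_have 6 → 9 := fun h => exists_completion_of_compress hn₀ (h p)
  tfae_have 9 → 1 := fun ⟨R, hR, hsum, hpos⟩ => mem_matQuotCones_of_completion hn₀ hR hsum hpos
  tfae_have 9 → 7 := fun ⟨R, hR, hsum, hpos⟩ =>
    mem_cstarCones_of_completion hn₀ hR hsum hpos (freeUnitary_mul_star n)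
  tfae_have 7 → 6 := fun h r C hC => compress_mem_of_cstar hn₀ h C hC
  tfae_have 8 → 9 := fun ⟨B, hB, hpos⟩ => by
    -- The `n` diagonal blocks contribute `n² A₁₁` besides the `B_i`, hence the sum `n - n²`
    -- required of the latter.
    refine ⟨fun i j => if i = j then (n : ℂ) • A₁₁ + B i else A i j, fun i j hij => if_neg hij,
      ?_, ?_⟩
    · simp only [if_true, Finset.sum_add_distrib, hB, Finset.sum_const, Finset.card_univ,
        Fintype.card_fin, ← Nat.cast_smul_eq_nsmul ℂ, smul_smul, ← add_smul]
      congr 1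
      ring
    · rwa [sum_tensorMat_single_eq (fun i j hij => if_neg hij) fun i => if_pos rfl]
  tfae_have 9 → 8 := fun ⟨R, hR, hsum, hpos⟩ => by
    refine ⟨fun i => R i i - (n : ℂ) • A₁₁, ?_, ?_⟩
    · simp only [Finset.sum_sub_distrib, hsum, Finset.sum_const, Finset.card_univ,
        Fintype.card_fin, ← Nat.cast_smul_eq_nsmul ℂ, smul_smul, ← sub_smul]
      congr 1
      ring
    · rwa [← sum_tensorMat_single_eq hR fun i => by simp]
  tfae_finish
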